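/- Let $A\in\mathbb{R}^{N\times N}$ be symmetric positive semidefinite of rank $K$ and let $\mathcal{P}=\{P_m\}_{m=1}^M$ be a partition of $[N]=\{1,\dots,N\}$ into nonempty patches. Write $X_{mn}$ for the block of a matrix $X$ with rows in $P_m$ and columns in $P_n$, put $K_m=\operatorname{rank}A_{mm}$, and let $\|\cdot\|_2$, $\|\cdot\|_F$ be the spectral and Frobenius norms. Definitions. The patch-wise sparseness of $\psi\in\mathbb{R}^N$ is the number of patches $P$ with $\psi|_P\ne 0$. A set of intrinsic sparse modes of $A$ is a family $\psi_1,\dots,\psi_K$ with $A=\sum_{k=1}^K\psi_k\psi_k^T$ that minimizes the total patch-wise sparseness among all such decompositions with $K$ modes. Two modes are identifiable if the sets of patches on which they are nonzero differ. $\mathcal{P}$ is regular-sparse with respect to $A$ if there is a decomposition $A=\sum_{k=1}^K g_kg_k^T$ such that, on each patch $P_m$, those restrictions $g_k|_{P_m}$ that are nonzero are linearly independent. Local pieces constructed by the intrinsic sparse mode decomposition (ISMD) with symmetric input $X$ and local ranks $K_m$: on each patch take an orthonormal eigenbasis $h_{m,1},h_{m,2},\dots$ of $X_{mm}$ with eigenvalues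 $\gamma_{m,1}\ge\gamma_{m,2}\ge\cdots$ and set $H_m=[\gamma_{m,1}^{1/2}h_{m,1},\dots,\gamma_{m,K_m}^{1/2}h_{m,K_m}]$, so that $X_{mm}^{(t)}:=H_mH_m^T$ is the truncated eigendecomposition of $X_{mm}$ (equal to $A_{mm}$ if $X=A$); put $H_m^\dagger=(H_m^TH_m)^{-1}H_m^T$, $\Lambda_{mn}=H_m^\dagger X_{mn}(H_n^\dagger)^T$ and $\Sigma_{n;m}=\Lambda_{mn}\Lambda_{mn}^T$; let $D_m$ be a minimizer of $\sum_{n=1}^M\sum_{i\ne j}|(V^T\Sigma_{n;m}V)_{ij}|^2$ over the orthogonal $K_m\times K_m$ matrices $V$. The local pieces are $G_m=H_mD_m$. Lemma. Assume that $\mathcal{P}$ is regular-sparse with respect to $A$ and that the modes of some (equivalently, of every) set of intrinsic sparse modes of $A$ are pairwise identifiable. Then for every $C_{eig}$ there exist constants $C_{jd}$, $C$ and $\epsilon_0>0$, depending only on $A$, $\mathcal{P}$ and $C_{eig}$, such that the following holds for all $0<\epsilon\le\epsilon_0$ and all symmetric $\tilde A$ with $\|\tilde A\|_2\le 1$ for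 which $\hat A=A+\epsilon\tilde A$ is positive semidefinite. Let $G_m$ and $\hat G_m$ be local pieces constructed by the ISMD with inputs $A$ and $\hat A$, respectively, both with the local ranks $K_m$ of $A$, and suppose that the truncated local eigendecompositions used for $\hat A$ satisfy, for all $m\in[M]$, $$\hat A_{mm}^{(t)}=(I+\epsilon E_m^{(eig)})A_{mm}(I+\epsilon (E_m^{(eig)})^T),\qquad \|E_m^{(eig)}\|_2\le C_{eig},$$ with some matrices $E_m^{(eig)}$. Then for every $m$ there are matrices $E_m^{(jd)},R_m,J_m\in\mathbb{R}^{K_m\times K_m}$ with $$\hat G_m=(I+\epsilon E_m^{(eig)})\,G_m\,(I+\epsilon E_m^{(jd)}+R_m)\,J_m,\qquad \|E_m^{(jd)}\|_F\le C_{jd},\qquad \|R_m\|_F\le C\epsilon^2,$$ where $J_m$ is the product of a permutation matrix with a diagonal matrix having only $\pm1$ on its diagonal. -/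

import Mathlib

open Matrix

namespace ISMD

/-- Spectral norm of a real square matrix (the `ℓ² → ℓ²` operator norm). -/
noncomputable def specNorm {p : Type*} [Fintype p] [DecidableEq p] (A : Matrix p p ℝ) : ℝ :=
  ‖Matrix.toEuclideanCLM (n := p) (𝕜 := ℝ) A‖

/-- Frobenius norm of a real matrix. -/
noncomputable def frobNorm {p q : Type*} [Fintype p] [Fintype q] (A : Matrix p q ℝ) : ℝ :=
  Real.sqrt (∑ i, ∑ j, A i j ^ 2)

/-- The product of a permutation matrix with a diagonal matrix of signs. -/
def IsSignedPerm {k : ℕ} (J : Matrix (Fin k) (Fin k) ℝ) : Prop :=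
  ∃ (σ : Equiv.Perm (Fin k)) (s : Fin k → ℝ),
    (∀ i, s i = 1 ∨ s i = -1) ∧ J = σ.permMatrix ℝ * Matrix.diagonal s

/-- Left pseudo-inverse `H† = (Hᵀ H)⁻¹ Hᵀ` (for `H` with linearly independent columns). -/
noncomputable def pinv {p : Type*} [Fintype p] {r : ℕ} (H : Matrix p (Fin r) ℝ) :
    Matrix (Fin r) p ℝ :=
  (Hᵀ * H)⁻¹ * Hᵀ

/-- Restriction `ψ|_P` of a vector to a patch. -/
def restr {N : ℕ} (P : Finset (Fin N)) (ψ : Fin N → ℝ) : P → ℝ := fun i => ψ i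

/-- The block of `A` with rows in the patch `P` and columns in the patch `Q`. -/
def block {N : ℕ} (A : Matrix (Fin N) (Fin N) ℝ) (P Q : Finset (Fin N)) : Matrix P Q ℝ :=
  Matrix.of fun i j => A i j

/-- The set of patches on which `ψ` is not identically zero. -/
noncomputable def supportPatches {N : ℕ} (π : Finpartition (Finset.univ : Finset (Fin N)))
    (ψ : Fin N → ℝ) : Finset (Finset (Fin N)) :=
  open Classical in π.parts.filter fun P => restr P ψ ≠ 0

/-- Patch-wise sparseness `s(ψ; π)`. -/
noncomputable def sparseness {N : ℕ} (π : Finpartition (Finset.univ : Finset (Fin N)))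
    (ψ : Fin N → ℝ) : ℕ :=
  (supportPatches π ψ).card

/-- `A = ∑ₖ ψₖ ψₖᵀ` with as many modes as the rank of `A`. -/
def IsDecomposition {N : ℕ} (A : Matrix (Fin N) (Fin N) ℝ)
    (ψ : Fin A.rank → Fin N → ℝ) : Prop :=
  A = ∑ k, Matrix.vecMulVec (ψ k) (ψ k)

/-- `ψ` is a set of intrinsic sparse modes: a decomposition of `A` of least total patch-wise
sparseness. -/
def IsIntrinsicModes {N : ℕ} (π : Finpartition (Finset.univ : Finset (Fin N)))
    (A : Matrix (Fin N) (Fin N) ℝ) (ψ : Fin A.rank → Fin N → ℝ) : Prop :=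
  IsDecomposition A ψ ∧
    ∀ φ : Fin A.rank → Fin N → ℝ, IsDecomposition A φ →
      ∑ k, sparseness π (ψ k) ≤ ∑ k, sparseness π (φ k)

/-- `π` is regular-sparse with respect to `A`: for some decomposition the nonzero modes on each
patch are linearly independent there. -/
def IsRegularSparse {N : ℕ} (π : Finpartition (Finset.univ : Finset (Fin N)))
    (A : Matrix (Fin N) (Fin N) ℝ) : Prop :=
  ∃ g : Fin A.rank → Fin N → ℝ, IsDecomposition A g ∧
    ∀ P ∈ π.parts,
      LinearIndependent ℝ (fun k : {k : Fin A.rank // restr P (g k) ≠ 0} => restr P (g k))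

/-- Any two different modes of the family are identifiable, i.e. not supported on exactly the
same patches. -/
def PairwiseIdentifiable {N K : ℕ} (π : Finpartition (Finset.univ : Finset (Fin N)))
    (ψ : Fin K → Fin N → ℝ) : Prop :=
  ∀ k l, k ≠ l → supportPatches π (ψ k) ≠ supportPatches π (ψ l)

/-- `H = [√γ₁ h₁, …, √γ_r h_r]`, where `h₁, h₂, …` is an orthonormal basis of eigenvectors of `X`
with eigenvalues `γ₁ ≥ γ₂ ≥ …`. Thus `H Hᵀ` is the eigendecomposition of `X` truncated to its
`r` largest eigenvalues, which is `X` itself if `X` is positive semidefinite of rank `r`. -/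
def IsEigenFactor {p : Type*} [Fintype p] (X : Matrix p p ℝ) (r : ℕ)
    (H : Matrix p (Fin r) ℝ) : Prop :=
  ∃ (γ : Fin (Fintype.card p) → ℝ) (h : Fin (Fintype.card p) → p → ℝ)
    (hr : r ≤ Fintype.card p),
    Antitone γ ∧
    (∀ i j, h i ⬝ᵥ h j = if i = j then 1 else 0) ∧
    (∀ i, X *ᵥ h i = γ i • h i) ∧
    ∀ a j, H a j = Real.sqrt (γ (Fin.castLE hr j)) * h (Fin.castLE hr j) a

/-- The joint diagonalization objective `∑ₙ ∑_{i ≠ j} |(Vᵀ Sₙ V)ᵢⱼ|²`. -/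
noncomputable def offDiag {ι : Type*} [Fintype ι] {k : ℕ} (S : ι → Matrix (Fin k) (Fin k) ℝ)
    (V : Matrix (Fin k) (Fin k) ℝ) : ℝ :=
  ∑ n, ∑ i, ∑ j, if i ≠ j then ((Vᵀ * S n * V) i j) ^ 2 else 0

/-- `V` is a global minimizer of the joint diagonalization objective over orthogonal matrices. -/
def IsJointDiagonalizer {ι : Type*} [Fintype ι] {k : ℕ} (S : ι → Matrix (Fin k) (Fin k) ℝ)
    (V : Matrix (Fin k) (Fin k) ℝ) : Prop :=
  V ∈ Matrix.orthogonalGroup (Fin k) ℝ ∧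
    ∀ W ∈ Matrix.orthogonalGroup (Fin k) ℝ, offDiag S V ≤ offDiag S W

/-- `Λ_{mn} = H_m† X_{mn} (H_n†)ᵀ`. -/
noncomputable def corr {N : ℕ} {π : Finpartition (Finset.univ : Finset (Fin N))}
    (X : Matrix (Fin N) (Fin N) ℝ) {K : π.parts → ℕ}
    (H : ∀ m : π.parts, Matrix m.1 (Fin (K m)) ℝ) (m n : π.parts) :
    Matrix (Fin (K m)) (Fin (K n)) ℝ :=
  pinv (H m) * block X m.1 n.1 * (pinv (H n))ᵀ

/-- The first two steps of the intrinsic sparse mode decomposition with input `X`, partition `π`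
and local ranks `K`: on every patch, `H m` is a local (truncated) eigendecomposition of `X_{mm}`
and `D m` solves the joint diagonalization problem for the matrices
`Σ_{n;m} = Λ_{mn} Λ_{mn}ᵀ`. The local pieces constructed by the algorithm are `H m * D m`. -/
def IsLocalStep {N : ℕ} (π : Finpartition (Finset.univ : Finset (Fin N)))
    (X : Matrix (Fin N) (Fin N) ℝ) (K : π.parts → ℕ)
    (H : ∀ m : π.parts, Matrix m.1 (Fin (K m)) ℝ)
    (D : ∀ m : π.parts, Matrix (Fin (K m)) (Fin (K m)) ℝ) : Prop :=
  (∀ m : π.parts, IsEigenFactor (block X m.1 m.1) (K m) (H m)) ∧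
  ∀ m : π.parts,
    IsJointDiagonalizer (fun n : π.parts => corr X H m n * (corr X H m n)ᵀ) (D m)

/-- The local rank `K_m` of `A`, that is the rank of `A_{mm}`. -/
noncomputable def localRank {N : ℕ} {π : Finpartition (Finset.univ : Finset (Fin N))}
    (A : Matrix (Fin N) (Fin N) ℝ) (m : π.parts) : ℕ :=
  (block A m.1 m.1).rank

end ISMD

namespace ISMD

/-! Let the columns of `G m` be the nonzero restrictions to the patch of a set of intrinsic modes.
Comparing total sparseness with a regular-sparse decomposition shows that these columns are linearly
independent and that there are `localRank A m` of them. In these coordinates every block is `G m * L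
m n * (G n)ᵀ`, where `L m n` matches equal modes on the two patches. Hence `L m n * (L m n)ᵀ` is a
diagonal 0/1 matrix recording which modes of patch `m` are active on patch `n`. Identifiability says
that these diagonals separate the modes (`exists_local_factorization`).

Factors with the same Gram matrix differ by an orthogonal matrix, which the joint diagonalization
absorbs. The exact pieces are therefore `G m * W`, with `W` jointly diagonalizing the 0/1 diagonals.
The perturbed ones are `(1 + ε • E m) * G m * V`, with `V` jointly diagonalizing matrices within
`O(ε)` of the same diagonals (`exists_corr_perturbation_bound`). Testing minimality against the
identity shows that `V` diagonalizes the 0/1 family up to `O(ε)`. Because that family separates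
indices with gap 1, `V` is `O(ε)`-close to a signed permutation (`exists_isSignedPerm_near`). With
zero error, `W` is itself a signed permutation. The whole discrepancy fits into the first-order
term, so the quadratic remainder can be taken to be zero. -/

/-! ### Pseudo-inverses, Gram factors and truncated eigendecompositions -/

theorem pinv_mul_self {p : Type*} [Fintype p] {r : ℕ} {B : Matrix p (Fin r) ℝ}
    {Y : Matrix (Fin r) p ℝ} (hY : Y * B = 1) : pinv B * B = 1 := by
  have hu : IsUnit (Bᵀ * B) := by
    rw [← Matrix.mulVec_injective_iff_isUnit]
    refine (injective_iff_map_eq_zero (Matrix.mulVecLin (Bᵀ * B))).2 fun x hx => ?_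
    have h1 : B *ᵥ x = 0 := by
      have h2 : Bᴴ * B = Bᵀ * B := by rw [conjTranspose_eq_transpose_of_trivial]
      rw [← Matrix.conjTranspose_mul_self_mulVec_eq_zero, h2]
      exact hx
    have h3 : (Y * B) *ᵥ x = 0 := by rw [← Matrix.mulVec_mulVec, h1, Matrix.mulVec_zero]
    simpa [hY] using h3
  rw [pinv, Matrix.mul_assoc]
  exact Matrix.nonsing_inv_mul _ ((Matrix.isUnit_iff_isUnit_det _).1 hu)

theorem pinv_mul_orthogonal {p : Type*} [Fintype p] {r : ℕ} (B : Matrix p (Fin r) ℝ)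
    {Q : Matrix (Fin r) (Fin r) ℝ} (hQ : Qᵀ * Q = 1) : pinv (B * Q) = Qᵀ * pinv B := by
  have hQ' : Q * Qᵀ = 1 := mul_eq_one_comm.1 hQ
  have h1 : Q⁻¹ = Qᵀ := Matrix.inv_eq_left_inv hQ
  have h2 : (Qᵀ)⁻¹ = Q := Matrix.inv_eq_left_inv hQ'
  have h3 : (B * Q)ᵀ * (B * Q) = Qᵀ * ((Bᵀ * B) * Q) := by
    simp only [Matrix.transpose_mul, Matrix.mul_assoc]
  rw [pinv, pinv, h3, Matrix.mul_inv_rev, Matrix.mul_inv_rev, h1, h2, Matrix.transpose_mul]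
  calc Qᵀ * (Bᵀ * B)⁻¹ * Q * (Qᵀ * Bᵀ) = Qᵀ * (Bᵀ * B)⁻¹ * (Q * Qᵀ) * Bᵀ := by
        simp only [Matrix.mul_assoc]
    _ = _ := by rw [hQ', Matrix.mul_one, Matrix.mul_assoc]

/-- The witness is `Y * B'`. The matrix `B * Y - 1` kills `B`, hence kills `B * Bᵀ = B' * B'ᵀ`, and
so kills `B'`. -/
theorem exists_orthogonal_of_mul_transpose_eq {p : Type*} [Fintype p] [DecidableEq p] {r : ℕ}
    {B B' : Matrix p (Fin r) ℝ} {Y : Matrix (Fin r) p ℝ} (hY : Y * B = 1)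
    (h : B' * B'ᵀ = B * Bᵀ) : ∃ Q : Matrix (Fin r) (Fin r) ℝ, Qᵀ * Q = 1 ∧ B' = B * Q := by
  refine ⟨Y * B', ?_, ?_⟩
  · rw [mul_eq_one_comm, Matrix.transpose_mul]
    calc Y * B' * (B'ᵀ * Yᵀ) = Y * (B' * B'ᵀ) * Yᵀ := by simp only [Matrix.mul_assoc]
      _ = (Y * B) * (Y * B)ᵀ := by rw [h, Matrix.transpose_mul]; simp only [Matrix.mul_assoc]
      _ = 1 := by rw [hY, Matrix.transpose_one, Matrix.mul_one]
  · have h1 : (B * Y - 1) * B = 0 := by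
      rw [Matrix.sub_mul, Matrix.mul_assoc, hY, Matrix.mul_one, Matrix.one_mul, sub_self]
    have h2 : ((B * Y - 1) * B') * ((B * Y - 1) * B')ᴴ = 0 := by
      rw [conjTranspose_eq_transpose_of_trivial, Matrix.transpose_mul]
      calc (B * Y - 1) * B' * (B'ᵀ * (B * Y - 1)ᵀ)
          = (B * Y - 1) * (B' * B'ᵀ) * (B * Y - 1)ᵀ := by simp only [Matrix.mul_assoc]
        _ = ((B * Y - 1) * B) * Bᵀ * (B * Y - 1)ᵀ := by rw [h]; simp only [Matrix.mul_assoc]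
        _ = 0 := by rw [h1, Matrix.zero_mul, Matrix.zero_mul]
    rw [Matrix.self_mul_conjTranspose_eq_zero, Matrix.sub_mul, sub_eq_zero, Matrix.one_mul,
      Matrix.mul_assoc] at h2
    exact h2.symm

/-- The eigenvalues are nonnegative and decreasing, and exactly `X.rank` of them are nonzero, so
truncation discards only zeros. -/
theorem IsEigenFactor.mul_transpose {p : Type*} [Fintype p] [DecidableEq p] {X : Matrix p p ℝ}
    (hX : X.PosSemidef) {H : Matrix p (Fin X.rank) ℝ} (hH : IsEigenFactor X X.rank H) :
    H * Hᵀ = X := by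
  obtain ⟨γ, h, hr, hanti, horth, heig, hHe⟩ := hH
  let e : Fin (Fintype.card p) ≃ p := (Fintype.equivFin p).symm
  let O : Matrix p p ℝ := Matrix.of fun a i => h (e.symm i) a
  have hO : Oᵀ * O = 1 := by
    ext i j
    have := horth (e.symm i) (e.symm j)
    rw [Matrix.mul_apply, Matrix.one_apply]
    simp only [EmbeddingLike.apply_eq_iff_eq] at this
    rw [← this]
    rfl
  have hO' : O * Oᵀ = 1 := mul_eq_one_comm.1 hO
  have hXO : X * O = O * Matrix.diagonal (fun i => γ (e.symm i)) := by
    ext a i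
    rw [Matrix.mul_diagonal]
    have := congrFun (heig (e.symm i)) a
    simp only [Pi.smul_apply, smul_eq_mul] at this
    rw [mul_comm, show O a i = h (e.symm i) a from rfl, ← this]
    rfl
  have hXd : X = O * Matrix.diagonal (fun i => γ (e.symm i)) * Oᵀ := by
    rw [← hXO, Matrix.mul_assoc, hO', Matrix.mul_one]
  have hγ : ∀ i, 0 ≤ γ i := fun i => by
    have h1 := hX.dotProduct_mulVec_nonneg (h i)
    rw [heig i, dotProduct_smul, star_trivial, horth i i] at h1
    simpa using h1
  have hdet : ∀ {U : Matrix p p ℝ} {V : Matrix p p ℝ}, U * V = 1 → IsUnit U.det := fun hUV =>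
    Matrix.isUnit_det_of_right_inverse hUV
  have hrank : X.rank = Fintype.card {i // γ i ≠ 0} := by
    conv_lhs => rw [hXd]
    rw [Matrix.rank_mul_eq_left_of_isUnit_det _ _ (hdet hO),
      Matrix.rank_mul_eq_right_of_isUnit_det _ _ (hdet hO'), Matrix.rank_diagonal]
    exact Fintype.card_congr (e.symm.subtypeEquiv fun _ => Iff.rfl)
  -- A positive eigenvalue at such an index would make all earlier ones positive too, giving more
  -- nonzero eigenvalues than the rank.
  have hzero : ∀ i : Fin (Fintype.card p), X.rank ≤ i → γ i = 0 := by
    intro i hi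
    by_contra hne
    have hpos : 0 < γ i := lt_of_le_of_ne (hγ i) (Ne.symm hne)
    have hinj : Fintype.card (Fin (i + 1)) ≤ Fintype.card {i // γ i ≠ 0} := by
      refine Fintype.card_le_of_injective (fun j : Fin (i + 1) =>
        (⟨⟨j, by omega⟩, ?_⟩ : {i // γ i ≠ 0})) ?_
      · exact (hpos.trans_le (hanti (by rw [Fin.le_def]; simp only; omega))).ne'
      · intro a b hab
        simpa [Fin.ext_iff] using hab
    rw [Fintype.card_fin] at hinj
    omega
  ext a b
  have hsum : X a b = ∑ i, γ i * h i a * h i b := by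
    conv_lhs => rw [hXd]
    rw [Matrix.mul_apply, ← e.sum_comp]
    refine Finset.sum_congr rfl fun i _ => ?_
    rw [Matrix.mul_diagonal, Matrix.transpose_apply]
    simp only [O, Matrix.of_apply, Equiv.symm_apply_apply]
    ring
  rw [hsum, Matrix.mul_apply]
  have hterm : ∀ j : Fin X.rank, H a j * Hᵀ j b =
      γ (Fin.castLE hr j) * h (Fin.castLE hr j) a * h (Fin.castLE hr j) b := fun j => by
    rw [Matrix.transpose_apply, hHe, hHe]
    calc _ = (Real.sqrt (γ (Fin.castLE hr j)) * Real.sqrt (γ (Fin.castLE hr j)))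
          * h (Fin.castLE hr j) a * h (Fin.castLE hr j) b := by ring
      _ = _ := by rw [Real.mul_self_sqrt (hγ _)]
  rw [Finset.sum_congr rfl fun j _ => hterm j]
  refine Finset.sum_of_injOn (Fin.castLE hr) (Fin.castLE_injective hr).injOn (by simp) ?_
    (by simp)
  intro i _ hi
  rw [hzero i, zero_mul, zero_mul]
  by_contra hlt
  exact hi ⟨⟨i, not_le.1 hlt⟩, by simp, rfl⟩

/-! ### Signed permutations and orthogonal matrices close to them -/

theorem isSignedPerm_iff {k : ℕ} {J : Matrix (Fin k) (Fin k) ℝ} :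
    IsSignedPerm J ↔ ∃ (σ : Equiv.Perm (Fin k)) (s : Fin k → ℝ),
      (∀ i, s i = 1 ∨ s i = -1) ∧ ∀ i j, J i j = if σ j = i then s j else 0 := by
  constructor
  · rintro ⟨σ, s, hs, rfl⟩
    refine ⟨σ.symm, s, hs, fun i j => ?_⟩
    rw [Matrix.mul_diagonal]
    have h : (σ i = j) ↔ (σ.symm j = i) := by rw [Equiv.symm_apply_eq, eq_comm]
    simp [Equiv.Perm.permMatrix, PEquiv.toMatrix_apply, h]
  · rintro ⟨σ, s, hs, hJ⟩
    refine ⟨σ.symm, s, hs, ?_⟩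
    ext i j
    rw [Matrix.mul_diagonal, hJ]
    have h : (σ.symm i = j) ↔ (σ j = i) := by rw [Equiv.symm_apply_eq, eq_comm]
    simp [Equiv.Perm.permMatrix, PEquiv.toMatrix_apply, h]

theorem IsSignedPerm.transpose_mul {k : ℕ} {I J : Matrix (Fin k) (Fin k) ℝ}
    (hI : IsSignedPerm I) (hJ : IsSignedPerm J) : IsSignedPerm (Iᵀ * J) := by
  rw [isSignedPerm_iff] at *
  obtain ⟨σ, s, hs, hI⟩ := hI
  obtain ⟨τ, t, ht, hJ⟩ := hJ
  refine ⟨τ.trans σ.symm, fun j => s (σ.symm (τ j)) * t j, fun j => ?_, fun i j => ?_⟩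
  · rcases hs (σ.symm (τ j)) with h | h <;> rcases ht j with h' | h' <;> simp [h, h']
  · rw [Matrix.mul_apply, Finset.sum_eq_single (τ j)]
    · simp only [Matrix.transpose_apply, hI, hJ, Equiv.trans_apply]
      by_cases h : τ j = σ i
      · simp [h]
      · simp [Ne.symm h, Equiv.symm_apply_eq, h]
    · intro b _ hb
      rw [hJ, if_neg (Ne.symm hb), mul_zero]
    · simp

theorem IsSignedPerm.transpose_mul_self {k : ℕ} {J : Matrix (Fin k) (Fin k) ℝ}
    (hJ : IsSignedPerm J) : Jᵀ * J = 1 := by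
  rw [isSignedPerm_iff] at hJ
  obtain ⟨τ, t, ht, hJ⟩ := hJ
  ext i j
  rw [Matrix.mul_apply, Finset.sum_eq_single (τ j)]
  · rw [Matrix.transpose_apply, hJ, hJ, Matrix.one_apply]
    by_cases h : i = j
    · subst h
      rcases ht i with h | h <;> simp [h]
    · simp [h]
  · intro b _ hb
    rw [hJ b j, if_neg (Ne.symm hb), mul_zero]
  · simp

theorem sum_sq_row {k : ℕ} {V : Matrix (Fin k) (Fin k) ℝ} (hV : Vᵀ * V = 1) (i : Fin k) :
    ∑ j, V i j ^ 2 = 1 := by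
  have h := congrFun (congrFun (mul_eq_one_comm.1 hV : V * Vᵀ = 1) i) i
  rw [Matrix.mul_apply, Matrix.one_apply_eq] at h
  rw [← h]
  exact Finset.sum_congr rfl fun j _ => by rw [Matrix.transpose_apply, sq]

theorem sum_sq_col {k : ℕ} {V : Matrix (Fin k) (Fin k) ℝ} (hV : Vᵀ * V = 1) (j : Fin k) :
    ∑ i, V i j ^ 2 = 1 := by
  have h : Vᵀᵀ * Vᵀ = 1 := by rw [Matrix.transpose_transpose]; exact mul_eq_one_comm.1 hV
  exact sum_sq_row h j

theorem abs_entry_le_one {k : ℕ} {V : Matrix (Fin k) (Fin k) ℝ} (hV : Vᵀ * V = 1)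
    (i j : Fin k) : |V i j| ≤ 1 := by
  rw [← sq_le_one_iff_abs_le_one, ← sum_sq_row hV i]
  exact Finset.single_le_sum (f := fun j => V i j ^ 2) (fun _ _ => sq_nonneg _)
    (Finset.mem_univ j)

/-- An orthogonal matrix that nearly diagonalizes a separating family of `0/1` diagonal matrices
is close to a signed permutation matrix. -/
theorem exists_isSignedPerm_near {ι : Type*} {k : ℕ} {d : ι → Fin k → ℝ}
    (h01 : ∀ n i, d n i = 0 ∨ d n i = 1) (hsep : ∀ i j, i ≠ j → ∃ n, d n i ≠ d n j)
    {δ : ℝ} (hδ : 0 ≤ δ) (hδk : 4 * k ^ 2 * δ < 1)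
    {V : Matrix (Fin k) (Fin k) ℝ} (hV : Vᵀ * V = 1)
    (hdiag : ∀ n i j, i ≠ j → |(Vᵀ * Matrix.diagonal (d n) * V) i j| ≤ δ) :
    ∃ J : Matrix (Fin k) (Fin k) ℝ, IsSignedPerm J ∧ ∀ i j, |(V - J) i j| ≤ 2 * k ^ 2 * δ := by
  have hV' : V * Vᵀ = 1 := mul_eq_one_comm.1 hV
  let e : ι → Fin k → ℝ := fun n j => (Vᵀ * Matrix.diagonal (d n) * V) j j
  -- Orthogonality turns `Vᵀ * diagonal (d n) * V` into an approximate eigenvector equation: column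
  -- `j` of `V` is almost an eigenvector of `diagonal (d n)` with eigenvalue `e n j`.
  have hcomm : ∀ n i j, |(d n i - e n j) * V i j| ≤ k * δ := by
    intro n i j
    have h1 : d n i * V i j = ∑ l, V i l * (Vᵀ * Matrix.diagonal (d n) * V) l j := by
      have : Matrix.diagonal (d n) * V = V * (Vᵀ * Matrix.diagonal (d n) * V) := by
        rw [Matrix.mul_assoc, ← Matrix.mul_assoc V, hV', Matrix.one_mul]
      rw [← Matrix.diagonal_mul, this, Matrix.mul_apply]
    rw [← Finset.add_sum_erase _ _ (Finset.mem_univ j)] at h1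
    have h2 : (d n i - e n j) * V i j =
        ∑ l ∈ Finset.univ.erase j, V i l * (Vᵀ * Matrix.diagonal (d n) * V) l j := by
      rw [sub_mul, h1]; simp only [e]; ring
    rw [h2]
    calc _ ≤ ∑ l ∈ Finset.univ.erase j, |V i l * (Vᵀ * Matrix.diagonal (d n) * V) l j| :=
          Finset.abs_sum_le_sum_abs _ _
      _ ≤ ∑ _l ∈ Finset.univ.erase j, δ := Finset.sum_le_sum fun l hl => by
          rw [abs_mul]
          exact (mul_le_of_le_one_left (abs_nonneg _) (abs_entry_le_one hV i l)).trans
            (hdiag n l j (Finset.ne_of_mem_erase hl))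
      _ ≤ ∑ _l : Fin k, δ := Finset.sum_le_sum_of_subset_of_nonneg (Finset.erase_subset _ _)
          fun _ _ _ => hδ
      _ = k * δ := by simp
  set η : ℝ := 2 * (k * δ) with hη
  have hη0 : 0 ≤ η := by positivity
  -- Two indices separated by some `d n` have values at distance 1, so `e n j` is at least 1/2 away
  -- from one of them. This 1/2 is the source of the factor 2 in `η`.
  have hsmall : ∀ j i i', i ≠ i' → |V i j| ≤ η ∨ |V i' j| ≤ η := by
    intro j i i' hii
    obtain ⟨n, hn⟩ := hsep i i' hii
    have key : ∀ i, 1 / 2 ≤ |d n i - e n j| → |V i j| ≤ η := fun i h => by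
      have h1 := hcomm n i j
      rw [abs_mul] at h1
      nlinarith [abs_nonneg (V i j)]
    have hdist : |d n i - d n i'| = 1 := by
      rcases h01 n i with h | h <;> rcases h01 n i' with h' | h' <;> simp [h, h'] at hn ⊢
    by_cases h : 1 / 2 ≤ |d n i - e n j|
    · exact Or.inl (key i h)
    · refine Or.inr (key i' ?_)
      have := abs_sub_le (d n i) (e n j) (d n i')
      rw [hdist, abs_sub_comm (e n j)] at this
      linarith [not_le.1 h]
  rcases Nat.eq_zero_or_pos k with rfl | hk
  · exact ⟨1, ⟨1, 1, fun i => i.elim0, by ext i; exact Fin.elim0 i⟩, fun i => i.elim0⟩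
  have hk1 : (1 : ℝ) ≤ k := by exact_mod_cast hk
  have hkη : 2 * (k * η) < 1 := by rw [hη]; nlinarith
  have hη1 : η ≤ 1 := by nlinarith
  have hkη2 : k * η ^ 2 ≤ k * η := by
    have : η ^ 2 ≤ η := by nlinarith
    exact mul_le_mul_of_nonneg_left this (by positivity)
  have hηk : η ≤ k * η := le_mul_of_one_le_left hη0 hk1
  have hbig : ∀ j, ∃ i, η < |V i j| := by
    intro j
    by_contra! hcon
    have h1 : ∑ i, V i j ^ 2 ≤ ∑ _i : Fin k, η ^ 2 := Finset.sum_le_sum fun i _ => by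
      rw [← sq_abs]; exact pow_le_pow_left₀ (abs_nonneg _) (hcon i) 2
    rw [sum_sq_col hV] at h1
    simp at h1
    linarith
  choose σ hσ using hbig
  have hoff : ∀ i j, i ≠ σ j → |V i j| ≤ η := fun i j hij =>
    (hsmall j i (σ j) hij).resolve_right (not_le.2 (hσ j))
  -- Columns are unit vectors, so the one large entry carries all the mass except at most `k * η`.
  have hdom : ∀ j, 1 - k * η ≤ V (σ j) j ^ 2 := by
    intro j
    have h1 := sum_sq_col hV j
    rw [← Finset.add_sum_erase _ _ (Finset.mem_univ (σ j))] at h1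
    have h2 : ∑ i ∈ Finset.univ.erase (σ j), V i j ^ 2 ≤ k * η ^ 2 :=
      calc _ ≤ ∑ _i ∈ Finset.univ.erase (σ j), η ^ 2 := Finset.sum_le_sum fun i hi => by
            rw [← sq_abs]
            exact pow_le_pow_left₀ (abs_nonneg _) (hoff i j (Finset.ne_of_mem_erase hi)) 2
        _ ≤ ∑ _i : Fin k, η ^ 2 := Finset.sum_le_sum_of_subset_of_nonneg
            (Finset.erase_subset _ _) fun _ _ _ => sq_nonneg _
        _ = _ := by simp
    linarith
  -- Two columns sharing a dominant row would give that unit row squared mass at least `2 - 2 * k *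
  -- η > 1`.
  have hinj : Function.Injective σ := by
    intro a b hab
    by_contra hne
    have h1 : ∑ j ∈ {a, b}, V (σ a) j ^ 2 ≤ ∑ j, V (σ a) j ^ 2 :=
      Finset.sum_le_sum_of_subset_of_nonneg (Finset.subset_univ _) fun _ _ _ => sq_nonneg _
    rw [Finset.sum_pair hne, sum_sq_row hV] at h1
    have h2 := hdom a
    have h3 := hdom b
    rw [← hab] at h3
    linarith
  let s : Fin k → ℝ := fun j => if 0 ≤ V (σ j) j then 1 else -1
  refine ⟨Matrix.of fun i j => if σ j = i then s j else 0,
    isSignedPerm_iff.2 ⟨Equiv.ofBijective σ (Finite.injective_iff_bijective.1 hinj), s,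
      fun i => ?_, fun i j => rfl⟩, fun i j => ?_⟩
  · simp only [s]; split_ifs <;> simp
  · have hfin : k * η = 2 * k ^ 2 * δ := by rw [hη]; ring
    rw [← hfin, Matrix.sub_apply, Matrix.of_apply]
    by_cases h : σ j = i
    · subst h
      have h1 := hdom j
      have h2 := abs_le.1 (abs_entry_le_one hV (σ j) j)
      rw [if_pos rfl]
      simp only [s]
      split_ifs with h0
      · rw [abs_le]; constructor <;> nlinarith
      · rw [abs_le]; constructor <;> nlinarith
    · rw [if_neg h, sub_zero]
      exact (hoff i j (Ne.symm h)).trans hηk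

/-! ### Intrinsic modes on a single patch -/

theorem block_eq_sum {N : ℕ} {A : Matrix (Fin N) (Fin N) ℝ} {φ : Fin A.rank → Fin N → ℝ}
    (hφ : IsDecomposition A φ) (P Q : Finset (Fin N)) :
    block A P Q =
      Matrix.of (fun (a : P) k => φ k a) * (Matrix.of fun (a : Q) k => φ k a)ᵀ := by
  ext a b
  have h := congrFun (congrFun hφ a) b
  rw [Matrix.sum_apply] at h
  rw [block, Matrix.of_apply, h, Matrix.mul_apply]
  rfl

theorem rank_block_eq_finrank_span {N : ℕ} {A : Matrix (Fin N) (Fin N) ℝ}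
    {φ : Fin A.rank → Fin N → ℝ} (hφ : IsDecomposition A φ) (P : Finset (Fin N)) :
    (block A P P).rank = (Set.range fun k : {k // restr P (φ k) ≠ 0} => restr P (φ k)).finrank ℝ := by
  rw [block_eq_sum hφ, Matrix.rank_self_mul_transpose, Matrix.rank_eq_finrank_span_cols,
    Set.finrank]
  suffices h : Submodule.span ℝ (Set.range (Matrix.of fun (a : P) k => φ k a).col) =
      Submodule.span ℝ (Set.range fun k : {k // restr P (φ k) ≠ 0} => restr P (φ k)) by rw [h]
  refine le_antisymm (Submodule.span_le.2 ?_) (Submodule.span_mono ?_)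
  · rintro _ ⟨k, rfl⟩
    by_cases h : restr P (φ k) = 0
    · have : (Matrix.of fun (a : P) k => φ k a).col k = 0 := h
      rw [this]
      exact Submodule.zero_mem _
    · exact Submodule.subset_span ⟨⟨k, h⟩, rfl⟩
  · rintro _ ⟨k, rfl⟩
    exact ⟨k.1, rfl⟩

/-- Double counting of active pairs (mode, patch) allows total sparseness to be compared with local
ranks patch by patch. -/
theorem sum_sparseness {N K : ℕ} (π : Finpartition (Finset.univ : Finset (Fin N)))
    (φ : Fin K → Fin N → ℝ) :
    ∑ k, sparseness π (φ k) = ∑ P ∈ π.parts, Nat.card {k // restr P (φ k) ≠ 0} := by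
  classical
  simp only [sparseness, supportPatches, Finset.card_filter]
  rw [Finset.sum_comm]
  refine Finset.sum_congr rfl fun P _ => ?_
  rw [Nat.card_eq_fintype_card, Fintype.card_subtype, Finset.card_filter]

/-- Under regular-sparseness, the nonzero restrictions of intrinsic sparse modes to a patch are
linearly independent, and there are as many of them as the local rank. -/
theorem IsIntrinsicModes.linearIndependent_restr {N : ℕ}
    {π : Finpartition (Finset.univ : Finset (Fin N))} {A : Matrix (Fin N) (Fin N) ℝ}
    (hreg : IsRegularSparse π A) {ψ : Fin A.rank → Fin N → ℝ} (hψ : IsIntrinsicModes π A ψ)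
    {P : Finset (Fin N)} (hP : P ∈ π.parts) :
    LinearIndependent ℝ (fun k : {k // restr P (ψ k) ≠ 0} => restr P (ψ k)) ∧
      Nat.card {k // restr P (ψ k) ≠ 0} = (block A P P).rank := by
  classical
  obtain ⟨g, hg, hgP⟩ := hreg
  have hle : ∀ P ∈ π.parts, (block A P P).rank ≤ Nat.card {k // restr P (ψ k) ≠ 0} :=
    fun P _ => by
      rw [rank_block_eq_finrank_span hψ.1, Nat.card_eq_fintype_card]
      exact finrank_range_le_card _
  -- The regular-sparse family attains the local rank on every patch. Minimality of `ψ` then makes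
  -- the sum of the termwise inequalities `hle` an equality, which forces equality on each patch.
  have hge : ∑ P ∈ π.parts, Nat.card {k // restr P (ψ k) ≠ 0} ≤
      ∑ P ∈ π.parts, (block A P P).rank := by
    rw [← sum_sparseness]
    refine (hψ.2 g hg).trans (le_of_eq ?_)
    rw [sum_sparseness]
    refine Finset.sum_congr rfl fun P hP => ?_
    rw [rank_block_eq_finrank_span hg, Nat.card_eq_fintype_card,
      linearIndependent_iff_card_eq_finrank_span.1 (hgP P hP)]
  have heq := (Finset.sum_eq_sum_iff_of_le hle).1 (le_antisymm (Finset.sum_le_sum hle) hge) P hP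
  refine ⟨linearIndependent_iff_card_eq_finrank_span.2 ?_, heq.symm⟩
  rw [← rank_block_eq_finrank_span hψ.1, heq, Nat.card_eq_fintype_card]

/-- Under regular-sparseness, the intrinsic sparse modes that are active on a patch can be indexed
by the local rank, and the matrix of their restrictions has a left inverse. -/
theorem exists_active_index {N : ℕ}
    {π : Finpartition (Finset.univ : Finset (Fin N))} {A : Matrix (Fin N) (Fin N) ℝ}
    (hreg : IsRegularSparse π A) {ψ : Fin A.rank → Fin N → ℝ} (hψ : IsIntrinsicModes π A ψ) :
    ∃ (c : ∀ m : π.parts, Fin (localRank A m) → Fin A.rank)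
      (Y : ∀ m : π.parts, Matrix (Fin (localRank A m)) m.1 ℝ),
      (∀ m, Function.Injective (c m)) ∧
      (∀ m k, restr m.1 (ψ k) ≠ 0 ↔ k ∈ Set.range (c m)) ∧
      (∀ m, Y m * Matrix.of (fun (a : m.1) j => ψ (c m j) a) = 1) := by
  have h1 : ∀ m : π.parts, ∃ c : Fin (localRank A m) → Fin A.rank,
      ∃ Y : Matrix (Fin (localRank A m)) m.1 ℝ, Function.Injective c ∧
      (∀ k, restr m.1 (ψ k) ≠ 0 ↔ k ∈ Set.range c) ∧
      Y * Matrix.of (fun (a : m.1) j => ψ (c j) a) = 1 := by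
    intro m
    obtain ⟨hli, hcard⟩ := hψ.linearIndependent_restr hreg m.2
    let e : Fin (localRank A m) ≃ {k // restr m.1 (ψ k) ≠ 0} :=
      ((Finite.equivFin _).trans (finCongr hcard)).symm
    have hli' := hli.comp e e.injective
    have hinj : Function.Injective
        (Matrix.mulVec (Matrix.of fun (a : m.1) j => ψ (e j).1 a)) := by
      rw [Matrix.mulVec_injective_iff]
      exact hli'
    obtain ⟨f, hf⟩ := LinearMap.exists_leftInverse_of_injective
      (Matrix.toLin' (Matrix.of fun (a : m.1) j => ψ (e j).1 a)) (LinearMap.ker_eq_bot.2 hinj)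
    have hY : LinearMap.toMatrix' f * (Matrix.of fun (a : m.1) j => ψ (e j).1 a) = 1 := by
      conv_lhs => rw [← LinearMap.toMatrix'_toLin' (Matrix.of fun (a : m.1) j => ψ (e j).1 a)]
      rw [← LinearMap.toMatrix'_comp, hf, LinearMap.toMatrix'_id]
    refine ⟨fun j => (e j).1, LinearMap.toMatrix' f, Subtype.val_injective.comp e.injective, fun k => ?_, hY⟩
    constructor
    · intro hk
      exact ⟨e.symm ⟨k, hk⟩, by simp⟩
    · rintro ⟨j, rfl⟩
      exact (e j).2
  choose c Y h using h1
  exact ⟨c, Y, fun m => (h m).1, fun m => (h m).2.1, fun m => (h m).2.2⟩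

/-! ### Perturbation bounds in the spectral norm -/

section Perturbation

open scoped Matrix.Norms.L2Operator

theorem abs_entry_le_norm {p q : Type*} [Fintype p] [Fintype q] [DecidableEq p] [DecidableEq q]
    (M : Matrix p q ℝ) (i : p) (j : q) : |M i j| ≤ ‖M‖ := by
  have h := Matrix.l2_opNorm_mulVec M (EuclideanSpace.single j (1 : ℝ))
  rw [PiLp.norm_single, norm_one, mul_one] at h
  have h2 := (PiLp.norm_apply_le ((EuclideanSpace.equiv p ℝ).symm <|
    M *ᵥ (EuclideanSpace.single j (1 : ℝ)).ofLp) i).trans h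
  simpa using h2

theorem norm_transpose_eq {p q : Type*} [Fintype p] [Fintype q] [DecidableEq p] [DecidableEq q]
    (M : Matrix p q ℝ) : ‖Mᵀ‖ = ‖M‖ := by
  rw [← Matrix.conjTranspose_eq_transpose_of_trivial, Matrix.l2_opNorm_conjTranspose]

/-- `B * pinv B` is an orthogonal projection: symmetric and idempotent, so the C*-identity gives
`‖P‖ = ‖P‖ * ‖P‖`. -/
theorem norm_mul_pinv_le_one {p : Type*} [Fintype p] [DecidableEq p] {r : ℕ}
    {B : Matrix p (Fin r) ℝ} (hB : pinv B * B = 1) : ‖B * pinv B‖ ≤ 1 := by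
  have hsymm : (B * pinv B)ᴴ = B * pinv B := by
    have h : ((Bᵀ * B)⁻¹)ᵀ = (Bᵀ * B)⁻¹ := by
      rw [Matrix.transpose_nonsing_inv, Matrix.transpose_mul, Matrix.transpose_transpose]
    rw [conjTranspose_eq_transpose_of_trivial, pinv, Matrix.transpose_mul, Matrix.transpose_mul,
      Matrix.transpose_transpose, h, Matrix.mul_assoc]
  have hidem : (B * pinv B) * (B * pinv B) = B * pinv B := by
    rw [Matrix.mul_assoc, ← Matrix.mul_assoc (pinv B), hB, Matrix.one_mul]
  have h := Matrix.l2_opNorm_conjTranspose_mul_self (B * pinv B)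
  rw [hsymm, hidem] at h
  by_contra! hlt
  nlinarith

/-- `Y * B = 1 + Y * E * G` is invertible by a Neumann series, so `B` has a left inverse.
Multiplying by `pinv B` expresses `pinv B` as `Y` times a projection minus a term of norm at most
half its own, which is absorbed on the left. -/
theorem pinv_perturbation {p : Type*} [Fintype p] [DecidableEq p] {r : ℕ}
    {G : Matrix p (Fin r) ℝ} {Y : Matrix (Fin r) p ℝ} (hY : Y * G = 1) {E : Matrix p p ℝ}
    (hE : ‖Y‖ * ‖E‖ * ‖G‖ ≤ 1 / 2) :
    pinv ((1 + E) * G) * ((1 + E) * G) = 1 ∧ ‖pinv ((1 + E) * G)‖ ≤ 2 * ‖Y‖ := by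
  set B := (1 + E) * G with hBdef
  have hYEG : ‖Y * E * G‖ ≤ 1 / 2 :=
    ((Matrix.l2_opNorm_mul _ _).trans
      (mul_le_mul_of_nonneg_right (Matrix.l2_opNorm_mul _ _) (norm_nonneg _))).trans hE
  have hYB : Y * B = 1 - -(Y * E * G) := by
    rw [hBdef, Matrix.add_mul, Matrix.one_mul, Matrix.mul_add, hY, sub_neg_eq_add,
      Matrix.mul_assoc]
  have hunit : IsUnit (Y * B) := by
    rw [hYB]
    exact isUnit_one_sub_of_norm_lt_one (by rw [norm_neg]; linarith)
  have hinv : pinv B * B = 1 := by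
    refine pinv_mul_self (Y := (Y * B)⁻¹ * Y) ?_
    rw [Matrix.mul_assoc]
    exact Matrix.nonsing_inv_mul _ ((Matrix.isUnit_iff_isUnit_det _).1 hunit)
  refine ⟨hinv, ?_⟩
  have hP : pinv B = Y * (B * pinv B) - Y * E * G * pinv B := by
    rw [← Matrix.mul_assoc, hYB, ← Matrix.sub_mul]
    simp
  have h1 : ‖pinv B‖ ≤ ‖Y‖ * 1 + 1 / 2 * ‖pinv B‖ :=
    calc ‖pinv B‖ = ‖Y * (B * pinv B) - Y * E * G * pinv B‖ := by rw [← hP]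
      _ ≤ ‖Y * (B * pinv B)‖ + ‖Y * E * G * pinv B‖ := norm_sub_le _ _
      _ ≤ ‖Y‖ * 1 + 1 / 2 * ‖pinv B‖ := by
        refine add_le_add ((Matrix.l2_opNorm_mul _ _).trans ?_)
          ((Matrix.l2_opNorm_mul _ _).trans ?_)
        · exact mul_le_mul_of_nonneg_left (norm_mul_pinv_le_one hinv) (norm_nonneg _)
        · exact mul_le_mul_of_nonneg_right hYEG (norm_nonneg _)
  linarith

theorem norm_mul_le_of_le {p q r : Type*} [Fintype p] [Fintype q] [Fintype r] [DecidableEq p]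
    [DecidableEq q] [DecidableEq r] {M : Matrix p q ℝ} {M' : Matrix q r ℝ} {a b : ℝ}
    (ha : ‖M‖ ≤ a) (hb : ‖M'‖ ≤ b) : ‖M * M'‖ ≤ a * b :=
  (Matrix.l2_opNorm_mul _ _).trans
    (mul_le_mul ha hb (norm_nonneg _) ((norm_nonneg _).trans ha))

/-- For `B = G + ε • (E * G)`, the identity `pinv B * B = 1` gives `X = pinv B * E * G` exactly,
with no higher-order terms. -/
theorem exists_pinv_mul_eq_one_sub_smul {p : Type*} [Fintype p] [DecidableEq p] {r : ℕ}
    {G : Matrix p (Fin r) ℝ} {Y : Matrix (Fin r) p ℝ} (hY : Y * G = 1) {E : Matrix p p ℝ}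
    {a ε : ℝ} (ha : 0 ≤ a) (hε : 0 ≤ ε) (hεa : 2 * (ε * a ^ 3) ≤ 1)
    (hGa : ‖G‖ ≤ a) (hYa : ‖Y‖ ≤ a) (hEa : ‖E‖ ≤ a) :
    ‖pinv ((1 + ε • E) * G)‖ ≤ 2 * a ∧ ∃ X : Matrix (Fin r) (Fin r) ℝ, ‖X‖ ≤ 2 * a * a * a ∧
      pinv ((1 + ε • E) * G) * G = 1 - ε • X := by
  obtain ⟨h1, h2⟩ := pinv_perturbation (E := ε • E) hY (by
    rw [norm_smul, Real.norm_of_nonneg hε]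
    calc ‖Y‖ * (ε * ‖E‖) * ‖G‖ ≤ a * (ε * a) * a := by gcongr
      _ ≤ 1 / 2 := by nlinarith)
  have h3 : ‖pinv ((1 + ε • E) * G)‖ ≤ 2 * a := by linarith
  refine ⟨h3, pinv ((1 + ε • E) * G) * E * G,
    norm_mul_le_of_le (norm_mul_le_of_le h3 hEa) hGa, ?_⟩
  rw [eq_sub_iff_add_eq]
  conv_rhs => rw [← h1]
  rw [Matrix.add_mul 1, Matrix.mul_add, Matrix.one_mul, Matrix.smul_mul, Matrix.mul_smul,
    ← Matrix.mul_assoc _ E]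

theorem norm_perturbed_sub_le {r s : ℕ} {L U : Matrix (Fin r) (Fin s) ℝ}
    {X : Matrix (Fin r) (Fin r) ℝ} {X' : Matrix (Fin s) (Fin s) ℝ}
    {a ε : ℝ} (ha : 1 ≤ a) (hε : 0 ≤ ε) (hε1 : ε ≤ 1) (hLa : ‖L‖ ≤ a)
    (hU : ‖U‖ ≤ 2 * a * a * (2 * a)) (hX : ‖X‖ ≤ 2 * a * a * a) (hX' : ‖X'‖ ≤ 2 * a * a * a) :
    ∃ W, ‖W‖ ≤ 12 * a ^ 7 ∧ (1 - ε • X) * L * (1 - ε • X')ᵀ + ε • U = L + ε • W := by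
  have hX't : ‖X'ᵀ‖ ≤ 2 * a * a * a := by rwa [norm_transpose_eq]
  refine ⟨U - X * L - L * X'ᵀ + ε • (X * L * X'ᵀ), ?_, ?_⟩
  · have h2 : ‖X * L‖ ≤ 2 * a * a * a * a := norm_mul_le_of_le hX hLa
    have h3 : ‖L * X'ᵀ‖ ≤ a * (2 * a * a * a) := norm_mul_le_of_le hLa hX't
    have h4 : ‖ε • (X * L * X'ᵀ)‖ ≤ 1 * (2 * a * a * a * a * (2 * a * a * a)) := by
      rw [norm_smul, Real.norm_of_nonneg hε]
      exact mul_le_mul hε1 (norm_mul_le_of_le h2 hX't) (norm_nonneg _) zero_le_one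
    have h5 : ‖U - X * L - L * X'ᵀ + ε • (X * L * X'ᵀ)‖ ≤
        ‖U‖ + ‖X * L‖ + ‖L * X'ᵀ‖ + ‖ε • (X * L * X'ᵀ)‖ :=
      (norm_add_le _ _).trans (add_le_add_left
        ((norm_sub_le _ _).trans (add_le_add_left (norm_sub_le _ _) _)) _)
    have h6 : a ^ 3 ≤ a ^ 7 := pow_le_pow_right₀ ha (by norm_num)
    have h7 : a ^ 4 ≤ a ^ 7 := pow_le_pow_right₀ ha (by norm_num)
    calc _ ≤ 2 * a * a * (2 * a) + 2 * a * a * a * a + a * (2 * a * a * a) +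
          1 * (2 * a * a * a * a * (2 * a * a * a)) :=
          h5.trans (add_le_add (add_le_add (add_le_add hU h2) h3) h4)
      _ = 4 * a ^ 3 + 4 * a ^ 4 + 4 * a ^ 7 := by ring
      _ ≤ _ := by linarith
  · rw [Matrix.transpose_sub, Matrix.transpose_one, Matrix.transpose_smul]
    simp only [Matrix.sub_mul, Matrix.mul_sub, Matrix.one_mul, Matrix.mul_one, Matrix.smul_mul,
      Matrix.mul_smul, smul_add, smul_sub]
    abel

theorem norm_mul_transpose_sub_le {r s : ℕ} {L W : Matrix (Fin r) (Fin s) ℝ}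
    {a ε : ℝ} (ha : 1 ≤ a) (hε : 0 ≤ ε) (hε1 : ε ≤ 1) (hLa : ‖L‖ ≤ a) (hWn : ‖W‖ ≤ 12 * a ^ 7) :
    ‖(L + ε • W) * (L + ε • W)ᵀ - L * Lᵀ‖ ≤ 168 * a ^ 14 * ε := by
  have hexp : (L + ε • W) * (L + ε • W)ᵀ - L * Lᵀ =
      ε • (W * Lᵀ + L * Wᵀ + ε • (W * Wᵀ)) := by
    rw [Matrix.transpose_add, Matrix.transpose_smul]
    simp only [Matrix.add_mul, Matrix.mul_add, Matrix.smul_mul, Matrix.mul_smul, smul_add]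
    abel
  rw [hexp, norm_smul, Real.norm_of_nonneg hε, mul_comm]
  refine mul_le_mul_of_nonneg_right ?_ hε
  have hWt : ‖Wᵀ‖ ≤ 12 * a ^ 7 := by rwa [norm_transpose_eq]
  have h1 : ‖W * Lᵀ‖ ≤ 12 * a ^ 7 * a := norm_mul_le_of_le hWn (by rwa [norm_transpose_eq])
  have h2 : ‖L * Wᵀ‖ ≤ a * (12 * a ^ 7) := norm_mul_le_of_le hLa hWt
  have h3 : ‖ε • (W * Wᵀ)‖ ≤ 1 * (12 * a ^ 7 * (12 * a ^ 7)) := by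
    rw [norm_smul, Real.norm_of_nonneg hε]
    exact mul_le_mul hε1 (norm_mul_le_of_le hWn hWt) (norm_nonneg _) zero_le_one
  have h4 : a ^ 8 ≤ a ^ 14 := pow_le_pow_right₀ ha (by norm_num)
  calc _ ≤ ‖W * Lᵀ‖ + ‖L * Wᵀ‖ + ‖ε • (W * Wᵀ)‖ :=
        (norm_add_le _ _).trans (add_le_add_left (norm_add_le _ _) _)
    _ ≤ 12 * a ^ 7 * a + a * (12 * a ^ 7) + 1 * (12 * a ^ 7 * (12 * a ^ 7)) :=
        add_le_add (add_le_add h1 h2) h3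
    _ = 24 * a ^ 8 + 144 * a ^ 14 := by ring
    _ ≤ _ := by linarith

/-- The matrices `Λ Λᵀ` are Lipschitz in the size of the perturbation. -/
theorem norm_corr_mul_transpose_sub_le {p q : Type*} [Fintype p] [Fintype q] [DecidableEq p]
    [DecidableEq q] {r s : ℕ} {G : Matrix p (Fin r) ℝ} {G' : Matrix q (Fin s) ℝ}
    {Y : Matrix (Fin r) p ℝ} {Y' : Matrix (Fin s) q ℝ} (hY : Y * G = 1) (hY' : Y' * G' = 1)
    {L : Matrix (Fin r) (Fin s) ℝ} {T : Matrix p q ℝ} {E : Matrix p p ℝ} {E' : Matrix q q ℝ}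
    {a ε : ℝ} (ha : 1 ≤ a) (hε : 0 ≤ ε) (hεa : 2 * (ε * a ^ 3) ≤ 1)
    (hGa : ‖G‖ ≤ a) (hGa' : ‖G'‖ ≤ a) (hYa : ‖Y‖ ≤ a) (hYa' : ‖Y'‖ ≤ a) (hLa : ‖L‖ ≤ a)
    (hTa : ‖T‖ ≤ a) (hEa : ‖E‖ ≤ a) (hEa' : ‖E'‖ ≤ a) {Λ : Matrix (Fin r) (Fin s) ℝ}
    (hΛ : Λ = pinv ((1 + ε • E) * G) * (G * L * G'ᵀ + ε • T) * (pinv ((1 + ε • E') * G'))ᵀ) :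
    ‖Λ * Λᵀ - L * Lᵀ‖ ≤ 168 * a ^ 14 * ε := by
  have ha0 : 0 ≤ a := by linarith
  have hε1 : ε ≤ 1 := by
    have : (1 : ℝ) ≤ a ^ 3 := one_le_pow₀ ha
    nlinarith
  obtain ⟨hP, X, hX, hPG⟩ := exists_pinv_mul_eq_one_sub_smul hY ha0 hε hεa hGa hYa hEa
  obtain ⟨hP', X', hX', hPG'⟩ := exists_pinv_mul_eq_one_sub_smul hY' ha0 hε hεa hGa' hYa' hEa'
  generalize pinv ((1 + ε • E) * G) = P at *
  generalize pinv ((1 + ε • E') * G') = P' at *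
  have hU : ‖P * T * P'ᵀ‖ ≤ 2 * a * a * (2 * a) :=
    norm_mul_le_of_le (norm_mul_le_of_le hP hTa) (by rwa [norm_transpose_eq])
  have h1 : Λ = (P * G) * L * (P' * G')ᵀ + ε • (P * T * P'ᵀ) := by
    rw [hΛ, Matrix.transpose_mul, Matrix.mul_add, Matrix.add_mul, Matrix.mul_smul,
      Matrix.smul_mul]
    simp only [Matrix.mul_assoc]
  obtain ⟨W, hWn, hW⟩ := norm_perturbed_sub_le ha hε hε1 hLa hU hX hX'
  rw [h1, hPG, hPG', hW]
  exact norm_mul_transpose_sub_le ha hε hε1 hLa hWn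

/-- A block is obtained by multiplying with fixed coordinate selection matrices on both sides. -/
theorem exists_norm_block_le {N : ℕ} (P Q : Finset (Fin N)) :
    ∃ c, ∀ X : Matrix (Fin N) (Fin N) ℝ, ‖block X P Q‖ ≤ c * ‖X‖ := by
  refine ⟨‖(1 : Matrix (Fin N) (Fin N) ℝ).submatrix (Subtype.val : P → Fin N) id‖ *
    ‖(1 : Matrix (Fin N) (Fin N) ℝ).submatrix id (Subtype.val : Q → Fin N)‖, fun X => ?_⟩
  have h : block X P Q = (1 : Matrix (Fin N) (Fin N) ℝ).submatrix (Subtype.val : P → Fin N) id * X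
      * (1 : Matrix (Fin N) (Fin N) ℝ).submatrix id (Subtype.val : Q → Fin N) := by
    ext i j
    simp [block, Matrix.mul_apply, Matrix.one_apply]
  rw [h, mul_right_comm]
  exact norm_mul_le_of_le (Matrix.l2_opNorm_mul _ _) le_rfl

end Perturbation

/-! ### Joint diagonalization: change of coordinates and near-minimality -/

theorem IsJointDiagonalizer.conj {ι : Type*} [Fintype ι] {k : ℕ}
    {S : ι → Matrix (Fin k) (Fin k) ℝ} {Q V : Matrix (Fin k) (Fin k) ℝ} (hQ : Qᵀ * Q = 1)
    (hV : IsJointDiagonalizer (fun n => Qᵀ * S n * Q) V) : IsJointDiagonalizer S (Q * V) := by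
  have hQ' : Q * Qᵀ = 1 := mul_eq_one_comm.1 hQ
  have hconj : ∀ V, offDiag (fun n => Qᵀ * S n * Q) V = offDiag S (Q * V) := fun V => by
    simp only [offDiag, Matrix.transpose_mul, Matrix.mul_assoc]
  have hQm : Q ∈ Matrix.orthogonalGroup (Fin k) ℝ := (Matrix.mem_orthogonalGroup_iff _ _).2 hQ'
  have hQm' : Qᵀ ∈ Matrix.orthogonalGroup (Fin k) ℝ := (Matrix.mem_orthogonalGroup_iff _ _).2 (by
    rw [Matrix.transpose_transpose, hQ])
  refine ⟨mul_mem hQm hV.1, fun W hW => ?_⟩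
  have h := hV.2 (Qᵀ * W) (mul_mem hQm' hW)
  rwa [hconj, hconj, ← Matrix.mul_assoc, hQ', Matrix.one_mul] at h

theorem IsJointDiagonalizer.transpose_mul_self {ι : Type*} [Fintype ι] {k : ℕ}
    {S : ι → Matrix (Fin k) (Fin k) ℝ} {V : Matrix (Fin k) (Fin k) ℝ}
    (hV : IsJointDiagonalizer S V) : Vᵀ * V = 1 :=
  (Matrix.mem_orthogonalGroup_iff' _ _).1 hV.1

/-- The orthogonal factor on patch `n` cancels inside `Λ * Λᵀ`, leaving only a conjugation by the
one on patch `m`. -/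
theorem corr_mul_orthogonal {N : ℕ} {π : Finpartition (Finset.univ : Finset (Fin N))}
    (X : Matrix (Fin N) (Fin N) ℝ) {K : π.parts → ℕ}
    (B : ∀ m : π.parts, Matrix m.1 (Fin (K m)) ℝ)
    {Q : ∀ m : π.parts, Matrix (Fin (K m)) (Fin (K m)) ℝ} (hQ : ∀ m, (Q m)ᵀ * Q m = 1)
    (m n : π.parts) :
    corr X (fun m => B m * Q m) m n * (corr X (fun m => B m * Q m) m n)ᵀ =
      (Q m)ᵀ * (corr X B m n * (corr X B m n)ᵀ) * Q m := by
  have hQ' : Q n * (Q n)ᵀ = 1 := mul_eq_one_comm.1 (hQ n)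
  have h : corr X (fun m => B m * Q m) m n = (Q m)ᵀ * corr X B m n * Q n := by
    rw [corr, corr, pinv_mul_orthogonal _ (hQ m), pinv_mul_orthogonal _ (hQ n),
      Matrix.transpose_mul, Matrix.transpose_transpose]
    simp only [Matrix.mul_assoc]
  rw [h, Matrix.transpose_mul, Matrix.transpose_mul, Matrix.transpose_transpose]
  calc (Q m)ᵀ * corr X B m n * Q n * ((Q n)ᵀ * ((corr X B m n)ᵀ * Q m))
      = (Q m)ᵀ * corr X B m n * (Q n * (Q n)ᵀ) * (corr X B m n)ᵀ * Q m := by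
        simp only [Matrix.mul_assoc]
    _ = _ := by rw [hQ', Matrix.mul_one]; simp only [Matrix.mul_assoc]

theorem abs_mul_apply_le {k : ℕ} {M M' : Matrix (Fin k) (Fin k) ℝ} {a b : ℝ}
    (hM : ∀ i j, |M i j| ≤ a) (hM' : ∀ i j, |M' i j| ≤ b) (i j : Fin k) :
    |(M * M') i j| ≤ k * (a * b) := by
  rw [Matrix.mul_apply]
  calc _ ≤ ∑ l, |M i l * M' l j| := Finset.abs_sum_le_sum_abs _ _
    _ ≤ ∑ _l : Fin k, a * b := Finset.sum_le_sum fun l _ => by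
        rw [abs_mul]
        exact mul_le_mul (hM i l) (hM' l j) (abs_nonneg _) ((abs_nonneg _).trans (hM i l))
    _ = _ := by simp

theorem frobNorm_le {k : ℕ} {M : Matrix (Fin k) (Fin k) ℝ} {a : ℝ} (ha : 0 ≤ a)
    (hM : ∀ i j, |M i j| ≤ a) : frobNorm M ≤ k * a := by
  rw [frobNorm, Real.sqrt_le_left (by positivity)]
  calc ∑ i, ∑ j, M i j ^ 2 ≤ ∑ _i : Fin k, ∑ _j : Fin k, a ^ 2 :=
        Finset.sum_le_sum fun i _ => Finset.sum_le_sum fun j _ => by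
          rw [← sq_abs]; exact pow_le_pow_left₀ (abs_nonneg _) (hM i j) 2
    _ = (k * a) ^ 2 := by simp; ring

/-- A joint diagonalizer of nearly diagonal matrices nearly diagonalizes the diagonal ones. -/
theorem IsJointDiagonalizer.abs_apply_le {ι : Type*} [Fintype ι] {k : ℕ}
    {S : ι → Matrix (Fin k) (Fin k) ℝ} {d : ι → Fin k → ℝ} {δ : ℝ} (hδ : 0 ≤ δ)
    (hS : ∀ n i j, |(S n - Matrix.diagonal (d n)) i j| ≤ δ)
    {V : Matrix (Fin k) (Fin k) ℝ} (hV : IsJointDiagonalizer S V) (n : ι) {i j : Fin k}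
    (hij : i ≠ j) :
    |(Vᵀ * Matrix.diagonal (d n) * V) i j| ≤ (Fintype.card ι * k ^ 2 + 1 + k ^ 2) * δ := by
  have hVo := hV.transpose_mul_self
  -- The identity is a competitor, and its off-diagonal entries are entries of `S n - diagonal (d
  -- n)`.
  have h1 : offDiag S V ≤ Fintype.card ι * k ^ 2 * δ ^ 2 := by
    refine (hV.2 1 (one_mem _)).trans ?_
    calc offDiag S 1 ≤ ∑ _n : ι, ∑ _i : Fin k, ∑ _j : Fin k, δ ^ 2 :=
          Finset.sum_le_sum fun n _ => Finset.sum_le_sum fun i _ => Finset.sum_le_sum fun j _ => by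
            split_ifs with h
            · have := hS n i j
              rw [Matrix.sub_apply, Matrix.diagonal_apply_ne _ h, sub_zero] at this
              rw [Matrix.transpose_one, Matrix.one_mul, Matrix.mul_one, ← sq_abs]
              exact pow_le_pow_left₀ (abs_nonneg _) this 2
            · exact sq_nonneg _
      _ = _ := by simp; ring
  have h2 : ((Vᵀ * S n * V) i j) ^ 2 ≤ offDiag S V := by
    have hnn : ∀ n i j, 0 ≤ if i ≠ j then ((Vᵀ * S n * V) i j) ^ 2 else 0 := fun n i j => by
      split_ifs <;> positivity
    calc ((Vᵀ * S n * V) i j) ^ 2 = if i ≠ j then ((Vᵀ * S n * V) i j) ^ 2 else 0 := by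
          rw [if_pos hij]
      _ ≤ ∑ j, if i ≠ j then ((Vᵀ * S n * V) i j) ^ 2 else 0 :=
          Finset.single_le_sum (f := fun j => if i ≠ j then ((Vᵀ * S n * V) i j) ^ 2 else 0)
            (fun j _ => hnn n i j) (Finset.mem_univ j)
      _ ≤ ∑ i, ∑ j, if i ≠ j then ((Vᵀ * S n * V) i j) ^ 2 else 0 :=
          Finset.single_le_sum
            (f := fun i => ∑ j, if i ≠ j then ((Vᵀ * S n * V) i j) ^ 2 else 0)
            (fun i _ => Finset.sum_nonneg fun j _ => hnn n i j) (Finset.mem_univ i)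
      _ ≤ offDiag S V :=
          Finset.single_le_sum
            (f := fun n => ∑ i, ∑ j, if i ≠ j then ((Vᵀ * S n * V) i j) ^ 2 else 0)
            (fun n _ => Finset.sum_nonneg fun i _ => Finset.sum_nonneg fun j _ => hnn n i j)
            (Finset.mem_univ n)
  -- For `x ≥ 0` one has `x ≤ (x + 1) ^ 2`; this avoids a square root in the constant.
  have h3 : |(Vᵀ * S n * V) i j| ≤ (Fintype.card ι * k ^ 2 + 1) * δ := by
    refine abs_le_of_sq_le_sq ((h2.trans h1).trans ?_) (by positivity)
    rw [mul_pow]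
    have : (0 : ℝ) ≤ Fintype.card ι * k ^ 2 := by positivity
    exact mul_le_mul_of_nonneg_right (by nlinarith) (sq_nonneg _)
  have h4 : |(Vᵀ * (S n - Matrix.diagonal (d n)) * V) i j| ≤ k * (k * (1 * δ) * 1) :=
    abs_mul_apply_le (abs_mul_apply_le (fun i j => abs_entry_le_one hVo j i) (hS n))
      (abs_entry_le_one hVo) i j
  have h5 : (Vᵀ * Matrix.diagonal (d n) * V) i j =
      (Vᵀ * S n * V) i j - (Vᵀ * (S n - Matrix.diagonal (d n)) * V) i j := by
    rw [Matrix.mul_sub, Matrix.sub_mul, Matrix.sub_apply]; ring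
  rw [h5]
  refine (abs_sub _ _).trans ?_
  nlinarith

/-! ### Factorization of the blocks through the active modes, and its stability -/

/-- The blocks of `A` in the coordinates given by the active identifiable modes. -/
theorem exists_local_factorization {N : ℕ}
    {π : Finpartition (Finset.univ : Finset (Fin N))} {A : Matrix (Fin N) (Fin N) ℝ}
    (hreg : IsRegularSparse π A) {ψ : Fin A.rank → Fin N → ℝ} (hψ : IsIntrinsicModes π A ψ)
    (hid : PairwiseIdentifiable π ψ) :
    ∃ (G : ∀ m : π.parts, Matrix m.1 (Fin (localRank A m)) ℝ)
      (Y : ∀ m : π.parts, Matrix (Fin (localRank A m)) m.1 ℝ)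
      (L : ∀ m n : π.parts, Matrix (Fin (localRank A m)) (Fin (localRank A n)) ℝ)
      (d : ∀ m : π.parts, π.parts → Fin (localRank A m) → ℝ),
      (∀ m, Y m * G m = 1) ∧
      (∀ m n, block A m.1 n.1 = G m * L m n * (G n)ᵀ) ∧
      (∀ m, block A m.1 m.1 = G m * (G m)ᵀ) ∧
      (∀ m n, L m n * (L m n)ᵀ = Matrix.diagonal (d m n)) ∧
      (∀ m n i, d m n i = 0 ∨ d m n i = 1) ∧
      (∀ m i j, i ≠ j → ∃ n, d m n i ≠ d m n j) := by
  classical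
  obtain ⟨c, Y, hc, hact, hY⟩ := exists_active_index hreg hψ
  let G : ∀ m : π.parts, Matrix m.1 (Fin (localRank A m)) ℝ :=
    fun m => Matrix.of fun a j => ψ (c m j) a
  let L : ∀ m n : π.parts, Matrix (Fin (localRank A m)) (Fin (localRank A n)) ℝ :=
    fun m n => Matrix.of fun i j => if c m i = c n j then 1 else 0
  let d : ∀ m : π.parts, π.parts → Fin (localRank A m) → ℝ :=
    fun m n i => if c m i ∈ Set.range (c n) then 1 else 0
  have hzero : ∀ (m : π.parts) (a : m.1) k, k ∉ Set.range (c m) → ψ k a = 0 := by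
    intro m a k hk
    rw [← hact, not_not] at hk
    exact congrFun hk a
  -- Modes inactive on patch `n` contribute nothing to a block with columns there.
  have hsum : ∀ (m n : π.parts) (a : m.1) (b : n.1),
      A a b = ∑ j, ψ (c n j) a * ψ (c n j) b := by
    intro m n a b
    have h := congrFun (congrFun hψ.1 a) b
    rw [Matrix.sum_apply] at h
    rw [h]
    symm
    refine Finset.sum_of_injOn (c n) (hc n).injOn (by simp) (fun k _ hk => ?_) fun _ _ => rfl
    rw [Matrix.vecMulVec_apply, hzero n b k (by simpa using hk), mul_zero]
  -- A column of `L` selects the local copy of mode `k`; if there is none, `ψ k` vanishes on the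
  -- patch and both sides are zero.
  have hpick : ∀ (m : π.parts) (a : m.1) k,
      ∑ i, ψ (c m i) a * (if c m i = k then 1 else 0) = ψ k a := by
    intro m a k
    by_cases hk : k ∈ Set.range (c m)
    · obtain ⟨i, rfl⟩ := hk
      rw [Finset.sum_eq_single i]
      · simp
      · intro b _ hb
        rw [if_neg fun h => hb (hc m h), mul_zero]
      · simp
    · rw [hzero m a k hk]
      refine Finset.sum_eq_zero fun i _ => ?_
      rw [if_neg fun h => hk ⟨i, h⟩, mul_zero]
  refine ⟨G, Y, L, d, hY, fun m n => ?_, fun m => ?_, fun m n => ?_, fun m n i => ?_,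
    fun m i j hij => ?_⟩
  · ext a b
    rw [block, Matrix.of_apply, hsum m n, Matrix.mul_apply]
    refine Finset.sum_congr rfl fun j _ => ?_
    rw [Matrix.mul_apply, Matrix.transpose_apply]
    simp only [G, L, Matrix.of_apply]
    rw [hpick]
  · ext a b
    rw [block, Matrix.of_apply, hsum m m, Matrix.mul_apply]
    rfl
  · ext i j
    rw [Matrix.mul_apply]
    simp only [L, Matrix.transpose_apply, Matrix.of_apply]
    by_cases hij : i = j
    · subst hij
      rw [Matrix.diagonal_apply_eq]
      simp only [d]
      split_ifs with h
      · obtain ⟨l, hl⟩ := h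
        rw [Finset.sum_eq_single l]
        · simp [hl]
        · intro b _ hb
          rw [if_neg fun h => hb (hc n (h.symm.trans hl.symm)), mul_zero]
        · simp
      · refine Finset.sum_eq_zero fun l _ => ?_
        rw [if_neg fun h' => h ⟨l, h'.symm⟩, mul_zero]
    · rw [Matrix.diagonal_apply_ne _ hij]
      refine Finset.sum_eq_zero fun l _ => ?_
      by_cases h : c m i = c n l
      · rw [if_neg fun h' : c m j = c n l => hij (hc m (h.trans h'.symm)), mul_zero]
      · rw [if_neg h, zero_mul]
  · simp only [d]
    split_ifs <;> simp
  -- If no diagonal separated `i` from `j`, the two modes would be active on the same patches.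
  · have h := hid (c m i) (c m j) fun h => hij (hc m h)
    by_contra! hcon
    refine h (Finset.ext fun P => ?_)
    simp only [supportPatches, Finset.mem_filter, and_congr_right_iff]
    intro hP
    have h1 := hcon ⟨P, hP⟩
    rw [hact ⟨P, hP⟩, hact ⟨P, hP⟩]
    simp only [d] at h1
    split_ifs at h1 with h2 h3 h3
    · exact iff_of_true h2 h3
    · simp at h1
    · simp at h1
    · exact iff_of_false h2 h3

section Perturbation

open scoped Matrix.Norms.L2Operator

theorem exists_corr_perturbation_bound {N : ℕ}
    {π : Finpartition (Finset.univ : Finset (Fin N))} {A : Matrix (Fin N) (Fin N) ℝ}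
    {K : π.parts → ℕ} {G : ∀ m : π.parts, Matrix m.1 (Fin (K m)) ℝ}
    {Y : ∀ m : π.parts, Matrix (Fin (K m)) m.1 ℝ}
    {L : ∀ m n : π.parts, Matrix (Fin (K m)) (Fin (K n)) ℝ} (hY : ∀ m, Y m * G m = 1)
    (hblock : ∀ m n, block A m.1 n.1 = G m * L m n * (G n)ᵀ) (Ceig : ℝ) :
    ∃ C ε₁ : ℝ, 0 ≤ C ∧ 0 < ε₁ ∧ ∀ (ε : ℝ) (Atilde : Matrix (Fin N) (Fin N) ℝ)
      (E : ∀ m : π.parts, Matrix m.1 m.1 ℝ), 0 ≤ ε → ε ≤ ε₁ → specNorm Atilde ≤ 1 →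
      (∀ m, specNorm (E m) ≤ Ceig) →
      (∀ m, pinv ((1 + ε • E m) * G m) * ((1 + ε • E m) * G m) = 1) ∧
      ∀ m n i j, |(corr (A + ε • Atilde) (fun m => (1 + ε • E m) * G m) m n *
        (corr (A + ε • Atilde) (fun m => (1 + ε • E m) * G m) m n)ᵀ -
          L m n * (L m n)ᵀ : Matrix (Fin (K m)) (Fin (K m)) ℝ) i j| ≤ C * ε := by
  choose b hb using fun m n : π.parts => exists_norm_block_le m.1 n.1
  obtain ⟨aG, haG⟩ := Finite.exists_le fun m => ‖G m‖
  obtain ⟨aY, haY⟩ := Finite.exists_le fun m => ‖Y m‖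
  obtain ⟨aL, haL⟩ := Finite.exists_le fun mn : π.parts × π.parts => ‖L mn.1 mn.2‖
  obtain ⟨ab, hab⟩ := Finite.exists_le fun mn : π.parts × π.parts => |b mn.1 mn.2|
  -- One constant bounds all the data over the finitely many patches; including 1 makes its powers
  -- monotone.
  obtain ⟨a, ha⟩ := Finite.exists_le ![1, aG, aY, aL, ab, Ceig]
  have ha1 : 1 ≤ a := ha 0
  have haG' : aG ≤ a := ha 1
  have haY' : aY ≤ a := ha 2
  have haL' : aL ≤ a := ha 3
  have hab' : ab ≤ a := ha 4
  have hCa : Ceig ≤ a := ha 5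
  have ha3 : 0 < a ^ 3 := by positivity
  refine ⟨168 * a ^ 14, 1 / (2 * a ^ 3), by positivity, by positivity, ?_⟩
  intro ε Atilde E hε hε1 hAt hE
  have hεa : 2 * (ε * a ^ 3) ≤ 1 := by
    rw [le_div_iff₀ (by positivity)] at hε1
    linarith
  have hG : ∀ m, ‖G m‖ ≤ a := fun m => (haG m).trans haG'
  have hYn : ∀ m, ‖Y m‖ ≤ a := fun m => (haY m).trans haY'
  have hEn : ∀ m, ‖E m‖ ≤ a := fun m => (hE m).trans hCa
  refine ⟨fun m => ?_, fun m n i j => (abs_entry_le_norm _ i j).trans ?_⟩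
  · refine (pinv_perturbation (hY m) ?_).1
    rw [norm_smul, Real.norm_of_nonneg hε]
    calc ‖Y m‖ * (ε * ‖E m‖) * ‖G m‖ ≤ a * (ε * a) * a := by
          have := hG m; have := hYn m; have := hEn m; gcongr
      _ ≤ 1 / 2 := by nlinarith
  · have hT : ‖block Atilde m.1 n.1‖ ≤ a := by
      refine (hb m n Atilde).trans ?_
      calc b m n * ‖Atilde‖ ≤ |b m n| * 1 :=
            mul_le_mul (le_abs_self _) hAt (norm_nonneg _) (abs_nonneg _)
        _ ≤ a := by rw [mul_one]; exact (hab (m, n)).trans hab'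
    refine norm_corr_mul_transpose_sub_le (hY m) (hY n) ha1 hε hεa (hG m) (hG n) (hYn m) (hYn n)
      ((haL (m, n)).trans haL') hT (hEn m) (hEn n) ?_
    rw [← hblock]
    rfl

end Perturbation

/-! ### Comparison of exact and perturbed pieces -/

/-- Solving `V = W * (1 + ε • Ejd) * (Wᵀ * J)` for `Ejd` is possible exactly, since `W` and `J` are
orthogonal. Three matrix products and the passage from entries to the Frobenius norm cost one factor
`k` each. -/
theorem exists_local_piece_perturbation {p : Type*} [Fintype p] {k : ℕ} {F : Matrix p p ℝ}
    {G : Matrix p (Fin k) ℝ} {V W J : Matrix (Fin k) (Fin k) ℝ} (hW : IsSignedPerm W)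
    (hJ : IsSignedPerm J) {c ε : ℝ} (hc : 0 ≤ c) (hε : 0 < ε)
    (hV : ∀ i j, |(V - J) i j| ≤ c * ε) :
    ∃ Ejd J' : Matrix (Fin k) (Fin k) ℝ,
      F * G * V = F * (G * W) * (1 + ε • Ejd) * J' ∧ frobNorm Ejd ≤ k ^ 4 * c ∧
        IsSignedPerm J' := by
  have hWo := hW.transpose_mul_self
  have hJo := hJ.transpose_mul_self
  have hWo' : W * Wᵀ = 1 := mul_eq_one_comm.1 hWo
  have hJt : ∀ i j, |Jᵀ i j| ≤ 1 := fun i j => abs_entry_le_one hJo j i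
  have hWt : ∀ i j, |Wᵀ i j| ≤ 1 := fun i j => abs_entry_le_one hWo j i
  have hΔ : ∀ i j, |(ε⁻¹ • (V - J)) i j| ≤ c := fun i j => by
    rw [Matrix.smul_apply, smul_eq_mul, abs_mul, abs_inv, abs_of_pos hε, inv_mul_le_iff₀ hε,
      mul_comm]
    exact hV i j
  refine ⟨Wᵀ * (ε⁻¹ • (V - J)) * Jᵀ * W, Wᵀ * J, ?_, ?_, hW.transpose_mul hJ⟩
  · have h1 : W * (1 + ε • (Wᵀ * (ε⁻¹ • (V - J)) * Jᵀ * W)) * (Wᵀ * J) = V := by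
      rw [Matrix.mul_smul, Matrix.smul_mul, Matrix.smul_mul, smul_smul, mul_inv_cancel₀ hε.ne',
        one_smul, Matrix.mul_add, Matrix.mul_one, Matrix.add_mul]
      calc W * (Wᵀ * J) + W * (Wᵀ * (V - J) * Jᵀ * W) * (Wᵀ * J)
          = (W * Wᵀ) * J + (W * Wᵀ) * (V - J) * Jᵀ * (W * Wᵀ) * J := by
            simp only [Matrix.mul_assoc]
        _ = V := by
            rw [hWo', Matrix.one_mul, Matrix.one_mul, Matrix.mul_one, Matrix.mul_assoc _ Jᵀ,
              hJo, Matrix.mul_one, add_sub_cancel]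
    conv_lhs => rw [← h1]
    simp only [Matrix.mul_assoc]
  · refine (frobNorm_le (a := k * (k * (k * (1 * c) * 1) * 1)) (by positivity)
      (abs_mul_apply_le (abs_mul_apply_le (abs_mul_apply_le hWt hΔ) hJt)
        (abs_entry_le_one hWo))).trans (le_of_eq ?_)
    ring

/-- A factorization of the local Gram matrices turns the local step into joint diagonalization
problems in fixed coordinates. -/
theorem IsLocalStep.exists_orthogonal {N : ℕ}
    {π : Finpartition (Finset.univ : Finset (Fin N))} {X : Matrix (Fin N) (Fin N) ℝ}
    {K : π.parts → ℕ} {H : ∀ m : π.parts, Matrix m.1 (Fin (K m)) ℝ}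
    {D : ∀ m : π.parts, Matrix (Fin (K m)) (Fin (K m)) ℝ} (h : IsLocalStep π X K H D)
    {B : ∀ m : π.parts, Matrix m.1 (Fin (K m)) ℝ} (hB : ∀ m, pinv (B m) * B m = 1)
    (hH : ∀ m, H m * (H m)ᵀ = B m * (B m)ᵀ) (m : π.parts) :
    ∃ V : Matrix (Fin (K m)) (Fin (K m)) ℝ, H m * D m = B m * V ∧
      IsJointDiagonalizer (fun n => corr X B m n * (corr X B m n)ᵀ) V := by
  choose Q hQ hHQ using fun m => exists_orthogonal_of_mul_transpose_eq (hB m) (hH m)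
  obtain rfl : H = fun m => B m * Q m := funext hHQ
  refine ⟨Q m * D m, Matrix.mul_assoc _ _ _, IsJointDiagonalizer.conj (hQ m) ?_⟩
  have := h.2 m
  simp only [corr_mul_orthogonal X B hQ] at this
  exact this


end ISMD

theorem mainTheorem4 (N : ℕ) (A : Matrix (Fin N) (Fin N) ℝ) (hA : A.PosSemidef)
    (π : Finpartition (Finset.univ : Finset (Fin N)))
    (hreg : ISMD.IsRegularSparse π A)
    (hid : ∃ ψ : Fin A.rank → Fin N → ℝ,
      ISMD.IsIntrinsicModes π A ψ ∧ ISMD.PairwiseIdentifiable π ψ)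
    (Ceig : ℝ) :
    ∃ Cjd Crem ε₀ : ℝ, 0 < ε₀ ∧
      ∀ (ε : ℝ) (Atilde : Matrix (Fin N) (Fin N) ℝ), 0 < ε → ε ≤ ε₀ →
        Atilde.IsSymm → ISMD.specNorm Atilde ≤ 1 → (A + ε • Atilde).PosSemidef →
      ∀ (H Hhat : ∀ m : π.parts, Matrix m.1 (Fin (ISMD.localRank A m)) ℝ)
        (D Dhat : ∀ m : π.parts,
          Matrix (Fin (ISMD.localRank A m)) (Fin (ISMD.localRank A m)) ℝ)
        (Eeig : ∀ m : π.parts, Matrix m.1 m.1 ℝ),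
        ISMD.IsLocalStep π A (ISMD.localRank A) H D →
        ISMD.IsLocalStep π (A + ε • Atilde) (ISMD.localRank A) Hhat Dhat →
        (∀ m : π.parts,
          Hhat m * (Hhat m).transpose =
            (1 + ε • Eeig m) * ISMD.block A m.1 m.1 * (1 + ε • (Eeig m).transpose) ∧
          ISMD.specNorm (Eeig m) ≤ Ceig) →
        ∀ m : π.parts,
          ∃ Ejd R J : Matrix (Fin (ISMD.localRank A m)) (Fin (ISMD.localRank A m)) ℝ,
            Hhat m * Dhat m =
              (1 + ε • Eeig m) * (H m * D m) * (1 + ε • Ejd + R) * J ∧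
            ISMD.frobNorm Ejd ≤ Cjd ∧
            ISMD.frobNorm R ≤ Crem * ε ^ 2 ∧
            ISMD.IsSignedPerm J := by
  obtain ⟨ψ, hψ, hψid⟩ := hid
  obtain ⟨G, Y, L, d, hY, hblock, hdiag, hL, h01, hsep⟩ :=
    ISMD.exists_local_factorization hreg hψ hψid
  obtain ⟨C, ε₁, hC, hε₁, hpert⟩ := ISMD.exists_corr_perturbation_bound hY hblock Ceig
  let c : π.parts → ℝ := fun m =>
    (Fintype.card π.parts * (ISMD.localRank A m : ℝ) ^ 2 + 1 + (ISMD.localRank A m : ℝ) ^ 2) * C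
  have hc : ∀ m, 0 ≤ c m := fun m => by positivity
  obtain ⟨b, hb⟩ := Finite.exists_le fun m => 4 * (ISMD.localRank A m : ℝ) ^ 2 * c m
  obtain ⟨Cjd, hCjd⟩ := Finite.exists_le fun m =>
    (ISMD.localRank A m : ℝ) ^ 4 * (2 * (ISMD.localRank A m : ℝ) ^ 2 * c m)
  -- The remainder constant is 0. The bound `1 / (|b| + 1)` makes the strict smallness condition of
  -- `exists_isSignedPerm_near` hold on every patch.
  refine ⟨Cjd, 0, min ε₁ (1 / (|b| + 1)), by positivity, ?_⟩
  intro ε Atilde hε hε₀ _ hAt _ H Hhat D Dhat E hstep hstep' hE m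
  obtain ⟨hinv, hbound⟩ := hpert ε Atilde E hε.le (hε₀.trans (min_le_left _ _)) hAt
    fun m => (hE m).2
  have hG : ∀ m, ISMD.pinv (G m) * G m = 1 := fun m => ISMD.pinv_mul_self (hY m)
  obtain ⟨W, hHW, hW⟩ := hstep.exists_orthogonal hG (fun m => by
    have hpsd : (ISMD.block A m.1 m.1).PosSemidef := hA.submatrix _
    exact (ISMD.IsEigenFactor.mul_transpose hpsd (hstep.1 m)).trans (hdiag m)) m
  obtain ⟨V, hHV, hV⟩ := hstep'.exists_orthogonal hinv (fun m => by
    rw [(hE m).1, hdiag, Matrix.transpose_mul, Matrix.transpose_add, Matrix.transpose_one,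
      Matrix.transpose_smul]
    simp only [Matrix.mul_assoc]) m
  have hcorr : ∀ n, ISMD.corr A G m n = L m n := fun n => by
    rw [ISMD.corr, hblock]
    calc ISMD.pinv (G m) * (G m * L m n * (G n)ᵀ) * (ISMD.pinv (G n))ᵀ
        = (ISMD.pinv (G m) * G m) * L m n * (ISMD.pinv (G n) * G n)ᵀ := by
          rw [Matrix.transpose_mul]; simp only [Matrix.mul_assoc]
      _ = L m n := by rw [hG, hG, Matrix.transpose_one, Matrix.one_mul, Matrix.mul_one]
  -- For the exact input the matrices are already diagonal, so the estimate applies with error 0 and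
  -- identifies `W` with a signed permutation.
  obtain ⟨J₀, hJ₀, hWJ₀⟩ := ISMD.exists_isSignedPerm_near (h01 m) (hsep m) le_rfl (by simp)
    hW.transpose_mul_self fun n i j hij =>
      (hW.abs_apply_le (d := d m) le_rfl (fun n i j => by
        simp only [hcorr, hL, sub_self, Matrix.zero_apply, abs_zero, le_refl]) n hij).trans
        (by simp)
  have hWperm : ISMD.IsSignedPerm W := by
    have : W = J₀ := by
      ext i j
      have := hWJ₀ i j
      rw [mul_zero, abs_nonpos_iff, Matrix.sub_apply, sub_eq_zero] at this
      exact this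
    rwa [this]
  have hsmall : 4 * (ISMD.localRank A m : ℝ) ^ 2 * (c m * ε) < 1 := by
    have h1 : ε * (|b| + 1) ≤ 1 := by
      rw [← le_div_iff₀ (by positivity)]
      exact hε₀.trans (min_le_right _ _)
    have h2 := (hb m).trans (le_abs_self b)
    nlinarith
  obtain ⟨J, hJ, hVJ⟩ := ISMD.exists_isSignedPerm_near (h01 m) (hsep m)
    (mul_nonneg (hc m) hε.le) hsmall hV.transpose_mul_self fun n i j hij =>
      (hV.abs_apply_le (d := d m) (mul_nonneg hC hε.le) (fun n i j => by
        rw [← hL]; exact hbound m n i j) n hij).trans (le_of_eq (by simp only [c]; ring))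
  obtain ⟨Ejd, J', h1, h2, h3⟩ := ISMD.exists_local_piece_perturbation
    (F := 1 + ε • E m) (G := G m) hWperm hJ
    (c := 2 * (ISMD.localRank A m : ℝ) ^ 2 * c m) (by have := hc m; positivity) hε
    fun i j => (hVJ i j).trans (le_of_eq (by ring))
  refine ⟨Ejd, 0, J', ?_, h2.trans (hCjd m), by simp [ISMD.frobNorm], h3⟩
  rw [hHV, h1, hHW, add_zero]
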